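/- Let $X$ be a real Banach space, let $K$ be a nonempty compact Hausdorff space, and let $C(K)$ be the space of real-valued continuous functions on $K$ with the supremum norm. Write $B_{X^*}$ and $S_{X^*}$ for the closed unit ball and the unit sphere of $X^*$, and $\operatorname{Ext} C$ for the set of extreme points of a convex set $C$. For $x\in X$ with $\|x\|=1$, let $\mathfrak F(x)=\{x^*\in S_{X^*}:\ x^*(x)=1\}$ be the face of $B_{X^*}$ determined by $x$. Let $T\colon X\to C(K)$ be a U-embedding, that is, a linear isometry (not necessarily onto) such that for every $x^*\in S_{X^*}$ there is exactly one $\mu\in C(K)^*$ with $T^*\mu=x^*$ and $\|\mu\|=\|x^*\|$. Define $F_T\colon K\to X^*$ by $F_T(k)=T^*\delta_k$, i.e. $F_T(k)(x)=(Tx)(k)$. Let $A=F_T^{-1}(\operatorname{Ext}B_{X^*})\subset K$ be the U-core of $T$, and let $\operatorname{Ext}^+=F_T(A)$. Put $E=\overline{\operatorname{Ext}^+}^{w^*}$. Then $E=F_T(\overline{A})$, and $E$ is a proper U-suitable set. This means that $E$ is a $w^*$-closed subset of $B_{X^*}$ such that 1. $E\cap(-E)\cap S_{X^*}=\emptyset$;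 2. $E\cup(-E)=\overline{\operatorname{Ext}B_{X^*}}^{w^*}$; 3. for every $x\in X$ with $\|x\|=1$, $E\cap\mathfrak F(x)=E\cap\overline{\operatorname{Ext}\mathfrak F(x)}^{w^*}$. -/

import Mathlib

open scoped Pointwise

/-- `y` is a Hahn--Banach extension of `x` through `T`: `T* y = x` and `‖y‖ = ‖x‖`. -/
def IsHahnBanachExtension {X Y : Type*} [NormedAddCommGroup X] [NormedSpace ℝ X]
    [NormedAddCommGroup Y] [NormedSpace ℝ Y] (T : X →ₗᵢ[ℝ] Y)
    (x : StrongDual ℝ X) (y : StrongDual ℝ Y) : Prop :=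
  y.comp T.toContinuousLinearMap = x ∧ ‖y‖ = ‖x‖

/-- A linear isometry `T : X → Y` is a U-embedding if every norm-one functional on `X`
has a unique Hahn--Banach extension through `T`. -/
def IsUEmbedding {X Y : Type*} [NormedAddCommGroup X] [NormedSpace ℝ X]
    [NormedAddCommGroup Y] [NormedSpace ℝ Y] (T : X →ₗᵢ[ℝ] Y) : Prop :=
  ∀ x : StrongDual ℝ X, ‖x‖ = 1 → ∃! y : StrongDual ℝ Y, IsHahnBanachExtension T x y

/-- The closed unit ball of the dual of `X`, inside the dual with its weak-star topology. -/
def dualBall (X : Type*) [NormedAddCommGroup X] [NormedSpace ℝ X] : Set (WeakDual ℝ X) :=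
  {x | ‖WeakDual.toStrongDual x‖ ≤ 1}

/-- The unit sphere of the dual of `X`, inside the dual with its weak-star topology. -/
def dualSphere (X : Type*) [NormedAddCommGroup X] [NormedSpace ℝ X] : Set (WeakDual ℝ X) :=
  {x | ‖WeakDual.toStrongDual x‖ = 1}

/-- The face of the dual unit ball determined by `x`. -/
def dualFace {X : Type*} [NormedAddCommGroup X] [NormedSpace ℝ X] (x : X) :
    Set (WeakDual ℝ X) :=
  {φ | φ ∈ dualSphere X ∧ φ x = 1}

/-- The map `F_T = T* ∘ δ : K → X*`, that is, `F_T(k) = δ_k ∘ T`. -/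
noncomputable def dualMapOf {X K : Type*} [NormedAddCommGroup X] [NormedSpace ℝ X]
    [TopologicalSpace K] [CompactSpace K] (T : X →ₗᵢ[ℝ] C(K, ℝ)) (k : K) : WeakDual ℝ X :=
  StrongDual.toWeakDual ((ContinuousMap.evalCLM ℝ k).comp T.toContinuousLinearMap)

/-- The U-core of `T`: the preimage under `F_T` of the extreme points of the dual ball. -/
def uCore {X K : Type*} [NormedAddCommGroup X] [NormedSpace ℝ X]
    [TopologicalSpace K] [CompactSpace K] (T : X →ₗᵢ[ℝ] C(K, ℝ)) : Set K :=
  dualMapOf T ⁻¹' (dualBall X).extremePoints ℝ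

/-- `Ext⁺`, the image of the U-core under `F_T`. -/
def extPlus {X K : Type*} [NormedAddCommGroup X] [NormedSpace ℝ X]
    [TopologicalSpace K] [CompactSpace K] (T : X →ₗᵢ[ℝ] C(K, ℝ)) : Set (WeakDual ℝ X) :=
  dualMapOf T '' uCore T

/-- U-suitable sets. All closures are weak-star closures. -/
structure IsUSuitable {X : Type*} [NormedAddCommGroup X] [NormedSpace ℝ X]
    (E : Set (WeakDual ℝ X)) : Prop where
  isClosed : IsClosed E
  subset_ball : E ⊆ dualBall X
  inter_neg_inter_sphere : E ∩ (-E) ∩ dualSphere X = ∅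
  union_neg : E ∪ (-E) = closure ((dualBall X).extremePoints ℝ)

/-- Proper U-suitable sets. -/
structure IsProperUSuitable {X : Type*} [NormedAddCommGroup X] [NormedSpace ℝ X]
    (E : Set (WeakDual ℝ X)) : Prop extends IsUSuitable E where
  inter_face : ∀ x : X, ‖x‖ = 1 →
    E ∩ dualFace x = E ∩ closure ((dualFace x).extremePoints ℝ)

/-! Norm-one extreme functionals on `C(K)` are the `±δ_k`. The unique norm-preserving extension of a
norm-one extreme point of the ball of `X*` is again extreme, so that point is `±F_T(k)`; taking
closures gives condition 2, and compactness of `closure A` gives `E = F_T(closure A)`. If `F_T(k) =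
-F_T(l)` had norm one, uniqueness would force `δ_k = -δ_l`, which fails at the constant 1: condition
1.

For condition 3, let `F_T(k)` lie in the face of `x`, and let `L` be the closed set of `l` with
`F_T(l)` or `-F_T(l)` in the closure of the extreme points of that face. By Krein–Milman, `|T y k|`
is at most the supremum of `|T y|` over `L`, so Hahn–Banach extends `F_T(k)` to a functional of norm
at most one that only sees `L`. Uniqueness makes it `δ_k`, hence `k ∈ L` by Urysohn, and the value 1
at `x` fixes the sign. -/

theorem mem_dualBall_iff {X : Type*} [NormedAddCommGroup X] [NormedSpace ℝ X] {p : WeakDual ℝ X} :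
    p ∈ dualBall X ↔ ‖WeakDual.toStrongDual p‖ ≤ 1 := Iff.rfl

theorem mem_dualSphere_iff {X : Type*} [NormedAddCommGroup X] [NormedSpace ℝ X]
    {p : WeakDual ℝ X} : p ∈ dualSphere X ↔ ‖WeakDual.toStrongDual p‖ = 1 := Iff.rfl

/-- A functional whose values on the closed unit ball are at most `C` has norm at most `C`. -/
theorem StrongDual.norm_le_of_forall_apply_le {Y : Type*} [NormedAddCommGroup Y] [NormedSpace ℝ Y]
    (φ : StrongDual ℝ Y) {C : ℝ} (h : ∀ y, ‖y‖ ≤ 1 → φ y ≤ C) : ‖φ‖ ≤ C := by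
  refine ContinuousLinearMap.opNorm_le_of_unit_norm (by simpa using h 0 (by simp)) fun y hy => ?_
  rw [Real.norm_eq_abs, abs_le']
  refine ⟨h y hy.le, ?_⟩
  rw [← map_neg]
  exact h (-y) (by rw [norm_neg, hy])

/-! ### Extreme functionals on `C(K)` -/

/-- The functional `f ↦ μ (h * f)`. -/
noncomputable def mulFunctional {K : Type*} [TopologicalSpace K] [CompactSpace K]
    (h : C(K, ℝ)) (μ : StrongDual ℝ C(K, ℝ)) : StrongDual ℝ C(K, ℝ) :=
  μ.comp (ContinuousLinearMap.mul ℝ C(K, ℝ) h)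

theorem mulFunctional_apply {K : Type*} [TopologicalSpace K] [CompactSpace K]
    (h f : C(K, ℝ)) (μ : StrongDual ℝ C(K, ℝ)) : mulFunctional h μ f = μ (h * f) := rfl

/-- For `f`, `g` in the unit ball, `h f + (1 - h) g` is a pointwise convex combination, hence again
in the ball; take suprema over `f` and `g` separately. -/
theorem norm_mulFunctional_add_norm_mulFunctional_le {K : Type*} [TopologicalSpace K]
    [CompactSpace K] (h : C(K, ℝ)) (h0 : 0 ≤ h) (h1 : h ≤ 1) (μ : StrongDual ℝ C(K, ℝ)) :
    ‖mulFunctional h μ‖ + ‖mulFunctional (1 - h) μ‖ ≤ ‖μ‖ := by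
  rw [← le_sub_iff_add_le]
  refine StrongDual.norm_le_of_forall_apply_le _ fun f hf => ?_
  rw [le_sub_comm]
  refine StrongDual.norm_le_of_forall_apply_le _ fun g hg => ?_
  rw [le_sub_iff_add_le, mulFunctional_apply, mulFunctional_apply, ← map_add]
  refine (le_abs_self _).trans ((μ.le_opNorm _).trans ?_)
  refine mul_le_of_le_one_right (norm_nonneg _) ?_
  rw [ContinuousMap.norm_le _ zero_le_one]
  intro k
  have hk0 : 0 ≤ h k := h0 k
  have hk1 : h k ≤ 1 := h1 k
  have hfk := abs_le.1 ((f.norm_coe_le_norm k).trans hf)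
  have hgk := abs_le.1 ((g.norm_coe_le_norm k).trans hg)
  simp only [ContinuousMap.add_apply, ContinuousMap.mul_apply, ContinuousMap.sub_apply,
    ContinuousMap.one_apply, Real.norm_eq_abs, abs_le]
  constructor <;> nlinarith

/-- If an extreme functional of norm one is a sum of two functionals whose norms add up to at most
one, then both summands are multiples of it. -/
theorem exists_eq_smul_of_add_eq_of_mem_extremePoints {Y : Type*} [NormedAddCommGroup Y]
    [NormedSpace ℝ Y] {μ ν₁ ν₂ : StrongDual ℝ Y} (hμ : ‖μ‖ = 1)
    (hext : μ ∈ {ν : StrongDual ℝ Y | ‖ν‖ ≤ 1}.extremePoints ℝ) (hsum : ν₁ + ν₂ = μ)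
    (hle : ‖ν₁‖ + ‖ν₂‖ ≤ ‖μ‖) : ∃ t : ℝ, ν₁ = t • μ := by
  have hab : ‖ν₁‖ + ‖ν₂‖ = 1 := by
    refine le_antisymm (hμ ▸ hle) ?_
    rw [← hμ, ← hsum]
    exact norm_add_le _ _
  rcases (norm_nonneg ν₁).eq_or_lt with ha0 | ha0
  · exact ⟨0, by rw [norm_eq_zero.1 ha0.symm, zero_smul]⟩
  rcases (norm_nonneg ν₂).eq_or_lt with hb0 | hb0
  · rw [norm_eq_zero.1 hb0.symm, add_zero] at hsum
    exact ⟨1, by rw [one_smul, hsum]⟩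
  · have hunit : ∀ ν : StrongDual ℝ Y, 0 < ‖ν‖ → ‖‖ν‖⁻¹ • ν‖ ≤ 1 := fun ν hν => by
      rw [norm_smul, norm_inv, norm_norm, inv_mul_cancel₀ hν.ne']
    have key := hext.2 (hunit ν₁ ha0) (hunit ν₂ hb0) ⟨‖ν₁‖, ‖ν₂‖, ha0, hb0, hab, by
      rw [smul_inv_smul₀ ha0.ne', smul_inv_smul₀ hb0.ne', hsum]⟩
    exact ⟨‖ν₁‖, by rw [← key, smul_inv_smul₀ ha0.ne']⟩

/-- Multiplying an extreme functional of norm one by a function rescales the functional. -/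
theorem exists_apply_mul_eq_of_mem_extremePoints {K : Type*} [TopologicalSpace K] [CompactSpace K]
    {μ : StrongDual ℝ C(K, ℝ)} (hμ : ‖μ‖ = 1)
    (hext : μ ∈ {ν : StrongDual ℝ C(K, ℝ) | ‖ν‖ ≤ 1}.extremePoints ℝ)
    (h : C(K, ℝ)) (h0 : 0 ≤ h) (h1 : h ≤ 1) : ∃ t : ℝ, ∀ f, μ (h * f) = t * μ f := by
  have hsum : mulFunctional h μ + mulFunctional (1 - h) μ = μ := by
    ext f
    simp [mulFunctional_apply, sub_mul]
  obtain ⟨t, ht⟩ := exists_eq_smul_of_add_eq_of_mem_extremePoints hμ hext hsum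
    (norm_mulFunctional_add_norm_mulFunctional_le h h0 h1 μ)
  exact ⟨t, fun f => DFunLike.congr_fun ht f⟩

/-- This makes `μ / μ 1` multiplicative. For `0 ≤ h ≤ 1` the scaling factor is found by testing on
1; the identity is linear in `h`, so the general case follows by an affine change. -/
theorem apply_mul_mul_apply_one {K : Type*} [TopologicalSpace K] [CompactSpace K]
    {μ : StrongDual ℝ C(K, ℝ)} (hμ : ‖μ‖ = 1)
    (hext : μ ∈ {ν : StrongDual ℝ C(K, ℝ) | ‖ν‖ ≤ 1}.extremePoints ℝ)
    (h f : C(K, ℝ)) : μ (h * f) * μ 1 = μ h * μ f := by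
  have key : ∀ h : C(K, ℝ), 0 ≤ h → h ≤ 1 → μ (h * f) * μ 1 = μ h * μ f := by
    intro h h0 h1
    obtain ⟨t, ht⟩ := exists_apply_mul_eq_of_mem_extremePoints hμ hext h h0 h1
    have h1' := ht 1
    rw [mul_one] at h1'
    rw [ht, h1']
    ring
  -- Chosen so that `h / c + 1/2` takes values in `[0, 1]`; the `+ 1` keeps `c` positive when `h =
  -- 0`.
  set c := 2 * (‖h‖ + 1) with hc
  have hcpos : 0 < c := by positivity
  set g : C(K, ℝ) := c⁻¹ • h + (2⁻¹ : ℝ) • 1 with hg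
  have hgk : ∀ k, g k = c⁻¹ * h k + 2⁻¹ := fun k => by simp [hg]
  have hbound : ∀ k, |c⁻¹ * h k| ≤ 2⁻¹ := fun k => by
    rw [abs_mul, abs_of_pos (inv_pos.2 hcpos), inv_mul_le_iff₀ hcpos, hc]
    have := h.norm_coe_le_norm k
    rw [Real.norm_eq_abs] at this
    linarith
  have hkey := key g
    (fun k => by
      have := (abs_le.1 (hbound k)).1
      change 0 ≤ g k
      rw [hgk]
      linarith)
    (fun k => by
      have := (abs_le.1 (hbound k)).2
      change g k ≤ 1
      rw [hgk]
      linarith)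
  simp only [hg, add_mul, smul_mul_assoc, one_mul, map_add, map_smul, smul_eq_mul] at hkey
  have hcne : c⁻¹ ≠ 0 := (inv_pos.2 hcpos).ne'
  apply mul_left_cancel₀ hcne
  linear_combination hkey

/-- A norm-one extreme functional on `C(K)` is, up to sign, a point evaluation. -/
theorem eq_evalCLM_or_eq_neg_evalCLM {K : Type*} [TopologicalSpace K] [CompactSpace K] [T2Space K]
    {μ : StrongDual ℝ C(K, ℝ)} (hμ : ‖μ‖ = 1)
    (hext : μ ∈ {ν : StrongDual ℝ C(K, ℝ) | ‖ν‖ ≤ 1}.extremePoints ℝ) :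
    ∃ k : K, μ = ContinuousMap.evalCLM ℝ k ∨ μ = -ContinuousMap.evalCLM ℝ k := by
  have hmul := apply_mul_mul_apply_one hμ hext
  have hone : μ 1 ≠ 0 := by
    intro h0
    have hμ0 : ‖μ‖ ≤ 0 := StrongDual.norm_le_of_forall_apply_le _ fun f _ => by
      have hff := hmul f f
      rw [h0, mul_zero] at hff
      exact (mul_self_eq_zero.1 hff.symm).le
    rw [hμ] at hμ0
    exact not_lt_of_ge hμ0 zero_lt_one
  let ψ : WeakDual ℝ C(K, ℝ) := StrongDual.toWeakDual ((μ 1)⁻¹ • μ)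
  have hψ_apply : ∀ f, ψ f = (μ 1)⁻¹ * μ f := fun f => rfl
  have hψ : ψ ∈ WeakDual.characterSpace ℝ C(K, ℝ) := by
    rw [WeakDual.CharacterSpace.eq_set_map_one_map_mul]
    refine ⟨by rw [hψ_apply, inv_mul_cancel₀ hone], fun f g => ?_⟩
    rw [hψ_apply, hψ_apply, hψ_apply]
    field_simp
    linear_combination hmul f g
  obtain ⟨k, hk⟩ := (WeakDual.CharacterSpace.continuousMapEval_bijective K ℝ).2 ⟨ψ, hψ⟩
  have hμk : μ = μ 1 • (ContinuousMap.evalCLM ℝ k : StrongDual ℝ C(K, ℝ)) := by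
    ext f
    have hfk : f k = ψ f := DFunLike.congr_fun hk f
    simp only [smul_apply, ContinuousMap.evalCLM_apply, smul_eq_mul]
    rw [hfk, hψ_apply, mul_inv_cancel_left₀ hone]
  have : Nonempty K := ⟨k⟩
  have hle : |μ 1| ≤ 1 := by
    simpa [hμ] using μ.le_opNorm 1
  have hge : 1 ≤ |μ 1| := by
    rw [← hμ]
    refine ContinuousLinearMap.opNorm_le_bound _ (abs_nonneg _) fun f => ?_
    conv_lhs => rw [hμk]
    change ‖μ 1 * f k‖ ≤ _
    rw [norm_mul, Real.norm_eq_abs]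
    exact mul_le_mul_of_nonneg_left (f.norm_coe_le_norm k) (abs_nonneg _)
  refine ⟨k, ?_⟩
  rcases eq_or_eq_neg_of_abs_eq (le_antisymm hle hge) with h | h
  · left
    rw [hμk, h, one_smul]
  · right
    ext f
    rw [hμk, h]
    exact neg_one_mul (f k)

/-- A point of norm below one is the midpoint of `p ± q` for a small nonzero `q`. In the trivial
space 0 is extreme, hence `Nontrivial`. -/
theorem norm_toStrongDual_eq_one_of_mem_extremePoints {X : Type*} [NormedAddCommGroup X]
    [NormedSpace ℝ X] [Nontrivial X] {p : WeakDual ℝ X}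
    (hp : p ∈ (dualBall X).extremePoints ℝ) : ‖WeakDual.toStrongDual p‖ = 1 := by
  have hle : ‖WeakDual.toStrongDual p‖ ≤ 1 := hp.1
  refine hle.eq_of_not_lt fun hlt => ?_
  obtain ⟨x, hx⟩ := exists_ne (0 : X)
  obtain ⟨g, hg, -⟩ := exists_dual_vector ℝ x (norm_ne_zero_iff.2 hx)
  set c := 1 - ‖WeakDual.toStrongDual p‖ with hc
  have hc0 : 0 < c := sub_pos.2 hlt
  set q : WeakDual ℝ X := StrongDual.toWeakDual (c • g) with hq
  have hqn : ‖WeakDual.toStrongDual q‖ = c := by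
    change ‖c • g‖ = c
    rw [norm_smul, hg, mul_one, Real.norm_eq_abs, abs_of_pos hc0]
  have h1 : p + q = p := hp.2 (x₁ := p + q) (x₂ := p - q)
    (by
      rw [mem_dualBall_iff, map_add]
      refine (norm_add_le _ _).trans ?_
      rw [hqn, hc]; linarith)
    (by
      rw [mem_dualBall_iff, map_sub]
      refine (norm_sub_le _ _).trans ?_
      rw [hqn, hc]; linarith)
    ⟨2⁻¹, 2⁻¹, by norm_num, by norm_num, by norm_num, by
      rw [← smul_add, add_add_sub_cancel, ← two_smul ℝ p, inv_smul_smul₀ two_ne_zero]⟩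
  rw [add_eq_left] at h1
  rw [h1, map_zero, norm_zero] at hqn
  exact hc0.ne hqn

/-! ### Extreme points of the dual ball under a U-embedding -/

section UEmbedding

variable {X K : Type*} [NormedAddCommGroup X] [NormedSpace ℝ X] [TopologicalSpace K]
  [CompactSpace K]

theorem continuous_dualMapOf (T : X →ₗᵢ[ℝ] C(K, ℝ)) : Continuous (dualMapOf T) :=
  WeakDual.continuous_of_continuous_eval fun x => (T x).continuous

theorem dualMapOf_mem_dualBall (T : X →ₗᵢ[ℝ] C(K, ℝ)) (k : K) : dualMapOf T k ∈ dualBall X :=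
  ContinuousLinearMap.opNorm_le_bound _ zero_le_one fun x => by
    rw [one_mul, ← T.norm_map]
    exact (T x).norm_coe_le_norm k

/-- Restriction along an isometry does not increase the norm, so both functionals have norm exactly
one and uniqueness applies. -/
theorem IsUEmbedding.eq_of_comp_eq {T : X →ₗᵢ[ℝ] C(K, ℝ)} (hT : IsUEmbedding T)
    {μ ν : StrongDual ℝ C(K, ℝ)} (hμ : ‖μ‖ ≤ 1) (hν : ‖ν‖ ≤ 1)
    (hn : ‖μ.comp T.toContinuousLinearMap‖ = 1)
    (h : μ.comp T.toContinuousLinearMap = ν.comp T.toContinuousLinearMap) : μ = ν := by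
  have aux : ∀ ρ : StrongDual ℝ C(K, ℝ), ‖ρ‖ ≤ 1 → ‖ρ.comp T.toContinuousLinearMap‖ = 1 →
      ‖ρ‖ = 1 := fun ρ h1 h2 => by
    refine le_antisymm h1 (h2 ▸ ?_)
    refine ContinuousLinearMap.opNorm_le_bound _ ρ.opNorm_nonneg fun x => ?_
    rw [← T.norm_map x]
    exact ρ.le_opNorm _
  refine (hT _ hn).unique ⟨rfl, ?_⟩ ⟨h.symm, ?_⟩
  · rw [hn, aux μ hμ hn]
  · rw [hn, aux ν hν (h ▸ hn)]

theorem norm_evalCLM_le_one (k : K) :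
    ‖(ContinuousMap.evalCLM ℝ k : StrongDual ℝ C(K, ℝ))‖ ≤ 1 :=
  ContinuousLinearMap.opNorm_le_bound _ zero_le_one fun f => by
    rw [one_mul]; exact f.norm_coe_le_norm k

/-- Every extreme point of the dual ball lies, up to sign, in the range of `dualMapOf T`. -/
theorem IsUEmbedding.exists_eq_dualMapOf_or_eq_neg [T2Space K] [Nonempty K]
    {T : X →ₗᵢ[ℝ] C(K, ℝ)} (hT : IsUEmbedding T) {p : WeakDual ℝ X}
    (hp : p ∈ (dualBall X).extremePoints ℝ) :
    ∃ k, p = dualMapOf T k ∨ p = -dualMapOf T k := by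
  rcases subsingleton_or_nontrivial X with hX | hX
  · refine ⟨Classical.arbitrary K, Or.inl ?_⟩
    refine DFunLike.ext _ _ fun x => ?_
    rw [Subsingleton.elim x 0, map_zero, map_zero]
  have hp1 := norm_toStrongDual_eq_one_of_mem_extremePoints hp
  obtain ⟨μ, ⟨hμp, hμn⟩, -⟩ := hT _ hp1
  rw [hp1] at hμn
  have hcomp : ∀ ν ∈ {ν : StrongDual ℝ C(K, ℝ) | ‖ν‖ ≤ 1},
      StrongDual.toWeakDual (ν.comp T.toContinuousLinearMap) ∈ dualBall X := fun ν hν => by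
    refine ContinuousLinearMap.opNorm_le_bound _ zero_le_one fun x => ?_
    rw [← T.norm_map x]
    exact ν.le_of_opNorm_le hν _
  have hext : μ ∈ {ν : StrongDual ℝ C(K, ℝ) | ‖ν‖ ≤ 1}.extremePoints ℝ := by
    refine ⟨hμn.le, fun μ₁ h₁ μ₂ h₂ hseg => ?_⟩
    -- Restricting the segment to `X` and using extremality of `p`, `μ₁` also extends `p`.
    have h1p := hp.2 (hcomp μ₁ h₁) (hcomp μ₂ h₂) (by
      obtain ⟨a, b, ha, hb, hab, rfl⟩ := hseg
      refine ⟨a, b, ha, hb, hab, ?_⟩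
      refine DFunLike.ext _ _ fun x => ?_
      exact DFunLike.congr_fun hμp x)
    refine hT.eq_of_comp_eq h₁ hμn.le ?_ ?_
    · exact (congrArg (fun q => ‖WeakDual.toStrongDual q‖) h1p).trans hp1
    · exact Eq.trans h1p hμp.symm
  obtain ⟨k, hk | hk⟩ := eq_evalCLM_or_eq_neg_evalCLM hμn hext
  · refine ⟨k, Or.inl (DFunLike.ext _ _ fun x => ?_)⟩
    rw [hk] at hμp
    exact (DFunLike.congr_fun hμp x).symm
  · refine ⟨k, Or.inr (DFunLike.ext _ _ fun x => ?_)⟩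
    rw [hk] at hμp
    exact (DFunLike.congr_fun hμp x).symm

theorem IsUEmbedding.dualMapOf_ne_neg_dualMapOf {T : X →ₗᵢ[ℝ] C(K, ℝ)}
    (hT : IsUEmbedding T) {k l : K} (hk : dualMapOf T k ∈ dualSphere X) :
    dualMapOf T k ≠ -dualMapOf T l := fun h => by
  have := hT.eq_of_comp_eq (μ := ContinuousMap.evalCLM ℝ k) (ν := -ContinuousMap.evalCLM ℝ l)
    (norm_evalCLM_le_one k) ((ContinuousLinearMap.opNorm_neg _).trans_le (norm_evalCLM_le_one l))
    hk h
  have h1 := DFunLike.congr_fun this 1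
  norm_num at h1

theorem neg_mem_extremePoints_dualBall {p : WeakDual ℝ X}
    (hp : p ∈ (dualBall X).extremePoints ℝ) : -p ∈ (dualBall X).extremePoints ℝ := by
  have hneg : ∀ q ∈ dualBall X, -q ∈ dualBall X := fun q hq => by
    rwa [mem_dualBall_iff, map_neg, norm_neg]
  refine ⟨hneg p hp.1, fun p₁ h₁ p₂ h₂ ⟨a, b, ha, hb, hab, h⟩ => ?_⟩
  rw [← hp.2 (hneg _ h₁) (hneg _ h₂) ⟨a, b, ha, hb, hab, by
    rw [smul_neg, smul_neg, ← neg_add, h, neg_neg]⟩, neg_neg]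

theorem IsUEmbedding.extPlus_union_neg [T2Space K] [Nonempty K] {T : X →ₗᵢ[ℝ] C(K, ℝ)}
    (hT : IsUEmbedding T) : extPlus T ∪ -extPlus T = (dualBall X).extremePoints ℝ := by
  ext p
  constructor
  · rintro (⟨k, hk, rfl⟩ | ⟨k, hk, hkp⟩)
    · exact hk
    · rw [← neg_neg p, ← hkp]
      exact neg_mem_extremePoints_dualBall hk
  · intro hp
    obtain ⟨k, rfl | rfl⟩ := hT.exists_eq_dualMapOf_or_eq_neg hp
    · exact Or.inl ⟨k, hp, rfl⟩
    · refine Or.inr ⟨k, ?_, (neg_neg _).symm⟩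
      have := neg_mem_extremePoints_dualBall hp
      rwa [neg_neg] at this

end UEmbedding

/-! ### Faces of the dual ball: compact, convex, extreme -/

section Face

instance WeakDual.instLocallyConvexSpaceReal {X : Type*} [NormedAddCommGroup X]
    [NormedSpace ℝ X] : LocallyConvexSpace ℝ (WeakDual ℝ X) :=
  inferInstanceAs (LocallyConvexSpace ℝ (WeakBilin (topDualPairing ℝ X)))

variable {X : Type*} [NormedAddCommGroup X] [NormedSpace ℝ X]

theorem isCompact_dualBall : IsCompact (dualBall X) := by
  convert! WeakDual.isCompact_closedBall (𝕜 := ℝ) (0 : StrongDual ℝ X) 1 using 1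
  ext p
  simp [mem_dualBall_iff]

theorem dualFace_eq {x : X} (hx : ‖x‖ = 1) : dualFace x = dualBall X ∩ {p | p x = 1} := by
  ext p
  refine ⟨fun h => ⟨(mem_dualSphere_iff.1 h.1).le, h.2⟩, fun h => ⟨?_, h.2⟩⟩
  refine le_antisymm h.1 ?_
  have := (WeakDual.toStrongDual p).le_opNorm x
  rw [hx, mul_one] at this
  have hp : (WeakDual.toStrongDual p) x = 1 := h.2
  rwa [hp, norm_one] at this

theorem isCompact_dualFace {x : X} (hx : ‖x‖ = 1) : IsCompact (dualFace x) := by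
  rw [dualFace_eq hx]
  exact isCompact_dualBall.inter_right (isClosed_eq (WeakDual.eval_continuous x) continuous_const)

theorem convex_dualFace {x : X} (hx : ‖x‖ = 1) : Convex ℝ (dualFace x) := by
  rw [dualFace_eq hx]
  rintro p ⟨hp, hpx⟩ q ⟨hq, hqx⟩ a b ha hb hab
  refine ⟨?_, ?_⟩
  · rw [mem_dualBall_iff] at hp hq ⊢
    rw [map_add, map_smul, map_smul]
    refine (norm_add_le _ _).trans ?_
    rw [norm_smul, norm_smul, Real.norm_of_nonneg ha, Real.norm_of_nonneg hb]
    nlinarith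
  · change a * p x + b * q x = 1
    rw [Set.mem_ofPred_eq] at hpx hqx
    rw [hpx, hqx, mul_one, mul_one, hab]

theorem isExtreme_dualFace {x : X} (hx : ‖x‖ = 1) : IsExtreme ℝ (dualBall X) (dualFace x) := by
  have hle : ∀ p ∈ dualBall X, p x ≤ 1 := fun p hp => by
    have := (WeakDual.toStrongDual p).le_of_opNorm_le hp x
    rw [hx, mul_one] at this
    exact (le_abs_self _).trans this
  rw [dualFace_eq hx]
  refine ⟨Set.inter_subset_left, ?_⟩
  rintro p hp q hq r ⟨-, hr⟩ ⟨a, b, ha, hb, hab, rfl⟩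
  refine ⟨hp, ?_⟩
  have hr' : a * p x + b * q x = 1 := hr
  have h1 := hle p hp
  have h2 := hle q hq
  change p x = 1
  nlinarith

end Face

/-! ### Extensions carried by a closed set, and condition 3 -/

section FaceCore

variable {X K : Type*} [NormedAddCommGroup X] [NormedSpace ℝ X] [TopologicalSpace K]
  [CompactSpace K]

/-- A functional on `X` that is dominated by the supremum of `|T y|` over a closed set `L`
extends, without exceeding norm one, to a functional on `C(K)` dominated by the supremum over
`L`. -/
theorem exists_extension_dominated (T : X →ₗᵢ[ℝ] C(K, ℝ)) {L : Set K} (hL : IsClosed L)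
    (φ : StrongDual ℝ X)
    (hφ : ∀ (y : X) (c : ℝ), 0 ≤ c → (∀ l ∈ L, |T y l| ≤ c) → |φ y| ≤ c) :
    ∃ μ : StrongDual ℝ C(K, ℝ), μ.comp T.toContinuousLinearMap = φ ∧
      ∀ (f : C(K, ℝ)) (c : ℝ), 0 ≤ c → (∀ l ∈ L, |f l| ≤ c) → |μ f| ≤ c := by
  have : CompactSpace L := isCompact_iff_compactSpace.1 hL.isCompact
  -- The supremum seminorm over `L`, which is zero when `L` is empty.
  let N : Seminorm ℝ C(K, ℝ) :=
    (normSeminorm ℝ C(L, ℝ)).comp (ContinuousMap.compRightAlgHom ℝ ℝ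
      (⟨Subtype.val, continuous_subtype_val⟩ : C(L, K))).toLinearMap
  have hN : ∀ (f : C(K, ℝ)) (l : K), l ∈ L → |f l| ≤ N f := fun f l hl =>
    ((f.comp (⟨Subtype.val, continuous_subtype_val⟩ : C(L, K))).norm_coe_le_norm ⟨l, hl⟩)
  have hN' : ∀ (f : C(K, ℝ)) (c : ℝ), 0 ≤ c → (∀ l ∈ L, |f l| ≤ c) → N f ≤ c :=
    fun f c hc h => (ContinuousMap.norm_le _ hc).2 fun l => h l l.2
  have hNn : ∀ f, N f ≤ ‖f‖ := fun f =>
    hN' f _ (norm_nonneg _) fun l _ => f.norm_coe_le_norm l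
  let e := LinearEquiv.ofInjective T.toLinearMap T.injective
  have he : ∀ y, T (e.symm y) = y := fun y => LinearEquiv.ofInjective_symm_apply T.toLinearMap y
  let f₀ : LinearMap.range T.toLinearMap →ₗ[ℝ] ℝ := φ.toLinearMap ∘ₗ e.symm.toLinearMap
  obtain ⟨g, hg, hgN⟩ := exists_extension_of_le_sublinear ⟨_, f₀⟩ N
    (fun c hc f => by rw [map_smul_eq_mul, Real.norm_of_nonneg hc.le])
    (map_add_le_add N)
    (fun y => by
      refine (le_abs_self _).trans (hφ _ _ (apply_nonneg _ _) fun l hl => ?_)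
      exact (congrArg (fun f : C(K, ℝ) => |f l|) (he y)).trans_le (hN _ l hl))
  have hgabs : ∀ f, |g f| ≤ N f := fun f => by
    rw [abs_le']
    refine ⟨hgN f, ?_⟩
    rw [← map_neg, ← map_neg_eq_map N]
    exact hgN _
  refine ⟨g.mkContinuous 1 fun f => ?_, ?_, fun f c hc h => (hgabs f).trans (hN' f c hc h)⟩
  · rw [one_mul]
    exact (hgabs f).trans (hNn f)
  · ext y
    have h1 := hg (e y)
    refine h1.trans ?_
    change φ (e.symm (e y)) = φ y
    rw [e.symm_apply_apply]

/-- If `F_T(k)` has norm one and is dominated by the supremum of `|T y|` over a closed set `L`,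
then `k` lies in `L`. -/
theorem IsUEmbedding.mem_of_forall_abs_le [T2Space K] {T : X →ₗᵢ[ℝ] C(K, ℝ)} (hT : IsUEmbedding T)
    {L : Set K} (hL : IsClosed L) {k : K} (hk : dualMapOf T k ∈ dualSphere X)
    (h : ∀ (y : X) (c : ℝ), 0 ≤ c → (∀ l ∈ L, |T y l| ≤ c) → |T y k| ≤ c) : k ∈ L := by
  by_contra hkL
  obtain ⟨μ, hμ, hμL⟩ := exists_extension_dominated T hL
    ((ContinuousMap.evalCLM ℝ k).comp T.toContinuousLinearMap) h
  have hμ1 : ‖μ‖ ≤ 1 := ContinuousLinearMap.opNorm_le_bound _ zero_le_one fun f => by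
    rw [one_mul]
    exact hμL f _ (norm_nonneg _) fun l _ => f.norm_coe_le_norm l
  have heq : ContinuousMap.evalCLM ℝ k = μ :=
    hT.eq_of_comp_eq (norm_evalCLM_le_one k) hμ1 hk hμ.symm
  obtain ⟨f, hf0, hf1, -⟩ := exists_continuous_zero_one_of_isClosed hL (isClosed_singleton (x := k))
    (Set.disjoint_singleton_right.2 hkL)
  have h0 := hμL f 0 le_rfl fun l hl => by rw [hf0 hl]; simp
  rw [← heq, ContinuousMap.evalCLM_apply, hf1 rfl] at h0
  norm_num at h0

theorem IsUEmbedding.dualMapOf_mem_closure_extremePoints_dualFace [T2Space K] [Nonempty K]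
    {T : X →ₗᵢ[ℝ] C(K, ℝ)} (hT : IsUEmbedding T) {x : X} (hx : ‖x‖ = 1) {k : K}
    (hk : dualMapOf T k ∈ dualFace x) :
    dualMapOf T k ∈ closure ((dualFace x).extremePoints ℝ) := by
  set C := closure ((dualFace x).extremePoints ℝ)
  have hCface : C ⊆ dualFace x :=
    closure_minimal extremePoints_subset (isCompact_dualFace hx).isClosed
  set L : Set K := {l | dualMapOf T l ∈ C ∨ -dualMapOf T l ∈ C}
  have hLclosed : IsClosed L :=
    (isClosed_closure.preimage (continuous_dualMapOf T)).union
      (isClosed_closure.preimage (continuous_dualMapOf T).neg)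
  have hkL : k ∈ L := by
    refine hT.mem_of_forall_abs_le hLclosed hk.1 fun y c _ hyc => ?_
    have hmem : dualMapOf T k ∈ closure (convexHull ℝ ((dualFace x).extremePoints ℝ)) := by
      rw [closure_convexHull_extremePoints (isCompact_dualFace hx) (convex_dualFace hx)]
      exact hk
    have hsub : closure (convexHull ℝ ((dualFace x).extremePoints ℝ)) ⊆
        {p : WeakDual ℝ X | |p y| ≤ c} := by
      refine closure_minimal (convexHull_min ?_ ?_)
        (isClosed_le (WeakDual.eval_continuous y).abs continuous_const)
      · intro p hp
        have hpC : p ∈ C := subset_closure hp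
        obtain ⟨l, rfl | rfl⟩ := hT.exists_eq_dualMapOf_or_eq_neg
          ((isExtreme_dualFace hx).extremePoints_subset_extremePoints hp)
        · exact hyc l (Or.inl hpC)
        · change |-(T y l)| ≤ c
          rw [abs_neg]
          exact hyc l (Or.inr hpC)
      · intro p hp q hq a b ha hb hab
        change |a * p y + b * q y| ≤ c
        refine (abs_add_le _ _).trans ?_
        rw [abs_mul, abs_mul, abs_of_nonneg ha, abs_of_nonneg hb]
        rw [Set.mem_ofPred_eq] at hp hq
        calc a * |p y| + b * |q y| ≤ a * c + b * c := by gcongr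
          _ = c := by rw [← add_mul, hab, one_mul]
    exact hsub hmem
  rcases hkL with h | h
  · exact h
  · have h1 : -(T x k) = 1 := (hCface h).2
    have h2 : T x k = 1 := hk.2
    rw [h2] at h1
    norm_num at h1

end FaceCore

/-! ### Assembly -/

theorem mainTheorem6 {X K : Type*} [NormedAddCommGroup X] [NormedSpace ℝ X] [CompleteSpace X]
    [TopologicalSpace K] [CompactSpace K] [T2Space K] [Nonempty K]
    (T : X →ₗᵢ[ℝ] C(K, ℝ)) (hT : IsUEmbedding T) :
    dualMapOf T '' closure (uCore T) = closure (extPlus T) ∧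
      IsProperUSuitable (closure (extPlus T)) := by
  have himage : dualMapOf T '' closure (uCore T) = closure (extPlus T) :=
    image_closure_of_isCompact isClosed_closure.isCompact (continuous_dualMapOf T).continuousOn
  have hrange : ∀ p ∈ closure (extPlus T), ∃ k, dualMapOf T k = p := fun p hp => by
    rw [← himage] at hp
    obtain ⟨k, -, hk⟩ := hp
    exact ⟨k, hk⟩
  refine ⟨himage, ⟨isClosed_closure, ?_, ?_, ?_⟩, fun x hx => ?_⟩
  · intro p hp
    obtain ⟨k, rfl⟩ := hrange p hp
    exact dualMapOf_mem_dualBall T k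
  · rw [Set.eq_empty_iff_forall_notMem]
    rintro p ⟨⟨hp, hpn⟩, hps⟩
    obtain ⟨k, rfl⟩ := hrange p hp
    obtain ⟨l, hl⟩ := hrange _ hpn
    exact hT.dualMapOf_ne_neg_dualMapOf (l := l) hps (by rw [hl, neg_neg])
  · rw [neg_closure, ← closure_union, hT.extPlus_union_neg]
  · refine Set.Subset.antisymm ?_ (Set.inter_subset_inter_right _
      (closure_minimal extremePoints_subset (isCompact_dualFace hx).isClosed))
    rintro p ⟨hp, hpx⟩
    refine ⟨hp, ?_⟩
    obtain ⟨k, rfl⟩ := hrange p hp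
    exact hT.dualMapOf_mem_closure_extremePoints_dualFace hx hpx
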